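/- A $d$-dimensional vector addition system (VAS), $d\in\mathbb N$, is a pair $V=(s,T)$ with $s\in\mathbb N^d$ and $T\subseteq\mathbb Z^d$ finite. Its reachability set is the set of all $v\in\mathbb N^d$ for which there are $n\ge 0$ and $v_0,\dots,v_n\in\mathbb N^d$ with $v_0=s$, $v_n=v$ and $v_{i+1}-v_i\in T$ for all $i<n$. A $d$-dimensional VAS with states (VASS) is a triple $V=(s,T,Q)$ with $Q$ a finite set of states, $s\in Q\times\mathbb N^d$ and $T\subseteq Q\times\mathbb Z^d\times Q$ finite. For $q\in Q$, its reachability set in state $q$ is the set of all $v\in\mathbb N^d$ for which there are $n\ge 0$ and $(q_0,v_0),\dots,(q_n,v_n)\in Q\times\mathbb N^d$ with $(q_0,v_0)=s$, $(q_n,v_n)=(q,v)$ and $(q_i,\,v_{i+1}-v_i,\,q_{i+1})\in T$ for all $i<n$. For $I\subseteq\{1,\dots,d\}$ let $\pi_I:\mathbb N^d\to\mathbb N^{|I|}$ delete the coordinates not in $I$; the section of $S\subseteq\mathbb N^d$ with respect to $I$ and $u\in\mathbb N^{d-|I|}$ is $\pi_I(\{v\in S : \pi_{\{1,\dots,d\}\setminus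 I}(v)=u\})\subseteq\mathbb N^{|I|}$. Let $\mathrm{Reach}(\mathrm{VAS})$ be the family of reachability sets of all VASes (in all dimensions), $\mathrm{Reach}(\mathrm{VASS})$ the family of reachability sets of all VASSes in all their states, and $\mathrm{SecReach}(\mathrm{VAS})$ the family of all sections of sets in $\mathrm{Reach}(\mathrm{VAS})$; a set of vectors is always taken together with its dimension. Proposition. $\mathrm{Reach}(\mathrm{VAS})\subsetneq\mathrm{Reach}(\mathrm{VASS})\subsetneq\mathrm{SecReach}(\mathrm{VAS})$. Moreover, the strictness of the first inclusion is not only due to the empty set: there is a non-empty set in $\mathrm{Reach}(\mathrm{VASS})$ that is not in $\mathrm{Reach}(\mathrm{VAS})$. -/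

import Mathlib

/-- Adding the integer vector `t` to the configuration `v` gives the configuration `w`
(so in particular no coordinate becomes negative). -/
def VecStep {d : ℕ} (v : Fin d → ℕ) (t : Fin d → ℤ) (w : Fin d → ℕ) : Prop :=
  ∀ i, (v i : ℤ) + t i = (w i : ℤ)

/-- A `d`-dimensional vector addition system: a source configuration and a finite set of
transitions. -/
structure VAS (d : ℕ) where
  source : Fin d → ℕ
  transitions : Finset (Fin d → ℤ)

namespace VAS

/-- One step of a partial run. -/
def Step {d : ℕ} (V : VAS d) (v w : Fin d → ℕ) : Prop :=
  ∃ t ∈ V.transitions, VecStep v t w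

/-- The reachability set: targets of all (finite, possibly empty) runs from the source. -/
def reach {d : ℕ} (V : VAS d) : Set (Fin d → ℕ) :=
  {v | Relation.ReflTransGen V.Step V.source v}

end VAS

/-- A `d`-dimensional vector addition system with states, with finite set of states `Q`. -/
structure VASS (d : ℕ) where
  Q : Type
  finiteStates : Finite Q
  source : Q × (Fin d → ℕ)
  transitions : Finset (Q × (Fin d → ℤ) × Q)

namespace VASS

/-- One step of a run. -/
def Step {d : ℕ} (V : VASS d) (c c' : V.Q × (Fin d → ℕ)) : Prop :=
  ∃ t : Fin d → ℤ, (c.1, t, c'.1) ∈ V.transitions ∧ VecStep c.2 t c'.2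

/-- The reachability set in state `q`: vectors `v` such that `(q, v)` is the target of a
(finite, possibly empty) run from the source. -/
def reach {d : ℕ} (V : VASS d) (q : V.Q) : Set (Fin d → ℕ) :=
  {v | Relation.ReflTransGen V.Step V.source (q, v)}

end VASS

/-- The `I`-projection of a vector: remove the coordinates outside `I`, keeping the order of the
remaining ones. -/
def vecProj {d : ℕ} (I : Finset (Fin d)) (v : Fin d → ℕ) : Fin I.card → ℕ :=
  fun j => v (I.orderEmbOfFin rfl j)

/-- The section of `S` with respect to `I` and `u`: fix the coordinates outside `I` to `u` and
project to the coordinates in `I`. -/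
def vecSection {d : ℕ} (I : Finset (Fin d)) (u : Fin Iᶜ.card → ℕ) (S : Set (Fin d → ℕ)) :
    Set (Fin I.card → ℕ) :=
  vecProj I '' {v ∈ S | vecProj Iᶜ v = u}

/-- A set of vectors of natural numbers, together with its dimension. -/
abbrev VecSet : Type := Σ d : ℕ, Set (Fin d → ℕ)

/-- The family of all reachability sets of vector addition systems. -/
def ReachVAS : Set VecSet :=
  {X | ∃ (d : ℕ) (V : VAS d), X = ⟨d, V.reach⟩}

/-- The family of all reachability sets, in some state, of vector addition systems with states. -/
def ReachVASS : Set VecSet :=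
  {X | ∃ (d : ℕ) (V : VASS d) (q : V.Q), X = ⟨d, V.reach q⟩}

/-- The family of all sections of reachability sets of vector addition systems. -/
def SecReachVAS : Set VecSet :=
  {X | ∃ (d : ℕ) (V : VAS d) (I : Finset (Fin d)) (u : Fin Iᶜ.card → ℕ),
    X = ⟨I.card, vecSection I u V.reach⟩}

/-! A state can be stored in extra counters holding a unit vector, which a section then fixes and
deletes; this gives the second inclusion. The first is strict because a VASS can hit {0, 2, 3} in a
single step and stop, whereas a VAS may repeat a transition wherever it applies.

The second is strict because a section can demand that an auxiliary counter be empty. In this way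
`doublingSet` contains every (n, 2^n - 1), while all its points (x, y) satisfy x ≤ y < 2^x. Suppose
a two-counter VASS reaches exactly this set in state `q`. By well-quasi-ordering, every reachable
configuration lies in a finite set or is reached through one of finitely many configurations that
dominate a different predecessor (`exists_finite_or_repetition`). The difference δ can be pumped,
and the two bounds force it to be positive in both coordinates. Both counters can then be made
large, so walks in the control graph become executable.

Vertical lines meet the set in bounded pieces, so a cycle to the right combined with a later cycle
back cannot gain height (`VASS.slope_le_of_bounded`). Hence cycles lie below lines whose slopes are
monotone along the control graph (`VASS.exists_slope`), and cutting runs into strongly connected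
components yields one line above all of them (`VASS.exists_linear_bound_of_slope`). Finitely many
lines cannot dominate 2^n - 1. -/

/-! ### Repetitions in well-quasi-ordered transition systems -/

/-- `StepsIn R n a b`: the element `b` is reached from `a` in exactly `n` steps of `R`. -/
inductive StepsIn {α : Type*} (R : α → α → Prop) : ℕ → α → α → Prop
  | refl (a : α) : StepsIn R 0 a a
  | head {n : ℕ} {a b c : α} : R a b → StepsIn R n b c → StepsIn R (n + 1) a c

namespace StepsIn

variable {α : Type*} {R : α → α → Prop}

theorem trans {m n : ℕ} {a b c : α} (h₁ : StepsIn R m a b) (h₂ : StepsIn R n b c) :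
    StepsIn R (m + n) a c := by
  induction h₁ with
  | refl => simpa using h₂
  | head hs _ ih => simpa only [Nat.add_right_comm] using (ih h₂).head hs

theorem reflTransGen {n : ℕ} {a b : α} (h : StepsIn R n a b) : Relation.ReflTransGen R a b := by
  induction h with
  | refl => exact .refl
  | head hs _ ih => exact .head hs ih

theorem exists_of_reflTransGen {a b : α} (h : Relation.ReflTransGen R a b) :
    ∃ n, StepsIn R n a b := by
  induction h using Relation.ReflTransGen.head_induction_on with
  | refl => exact ⟨0, .refl _⟩
  | head hs _ ih => exact ⟨_, ih.choose_spec.head hs⟩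

end StepsIn

/-- Enlarging a set by the elements above one of its non-members cannot go on forever in a
well-quasi-order. -/
theorem WellQuasiOrdered.wellFounded_adjoin {α : Type*} {r : α → α → Prop}
    (hr : WellQuasiOrdered r) :
    WellFounded fun U' U : Set α => ∃ c ∉ U, U' = {x | x ∈ U ∨ r c x} := by
  rw [wellFounded_iff_isEmpty_descending_chain]
  refine ⟨fun ⟨f, hf⟩ => ?_⟩
  choose c hc hU using hf
  have hsub : Monotone f := monotone_nat_of_le_succ fun n x hx => by
    rw [hU n]; exact Or.inl hx
  obtain ⟨m, n, hmn, h⟩ := hr c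
  refine hc n (hsub (Nat.succ_le_of_lt hmn) ?_)
  rw [hU m]
  exact Or.inr h

/-- Well-founded induction on `U`, the set of elements known to dominate something seen earlier:
adjoin everything above `c` and recurse into the finitely many successors of `c`. The step counts
allow the caller to apply this to a shortest run. -/
theorem exists_finite_or_repetition_aux {α : Type*} {r R : α → α → Prop}
    (hr : WellQuasiOrdered r) (hR : ∀ a, {b | R a b}.Finite) (U : Set α) :
    ∀ c ∉ U, ∃ F : Set α, F.Finite ∧ ∀ n b, StepsIn R n c b → b ∈ F ∨ ∃ e ∈ F, ∃ i j,
      StepsIn R i c e ∧ StepsIn R j e b ∧ i + j = n ∧ (e ∈ U ∨ ∃ e₀ k l,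
        StepsIn R k c e₀ ∧ StepsIn R (l + 1) e₀ e ∧ k + (l + 1) = i ∧ r e₀ e) := by
  induction U using hr.wellFounded_adjoin.induction with
  | _ U ih =>
  intro c hc
  have key : ∀ c', ∃ F : Set α, F.Finite ∧ ∀ n b, StepsIn R n c' b → b ∈ F ∨ ∃ e ∈ F, ∃ i j,
      StepsIn R i c' e ∧ StepsIn R j e b ∧ i + j = n ∧ ((e ∈ U ∨ r c e) ∨ ∃ e₀ k l,
        StepsIn R k c' e₀ ∧ StepsIn R (l + 1) e₀ e ∧ k + (l + 1) = i ∧ r e₀ e) := by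
    intro c'
    by_cases h : c' ∈ {x | x ∈ U ∨ r c x}
    · exact ⟨{c'}, Set.finite_singleton _, fun n b hb =>
        Or.inr ⟨c', rfl, 0, n, .refl _, hb, by simp, Or.inl h⟩⟩
    · exact ih _ ⟨c, hc, rfl⟩ c' h
  choose G hG hG' using key
  refine ⟨{c} ∪ ⋃ c' ∈ {b | R c b}, G c', (Set.finite_singleton _).union
    ((hR c).biUnion fun c' _ => hG c'), fun n b hb => ?_⟩
  cases hb with
  | refl => exact Or.inl (Or.inl rfl)
  | @head n _ c' _ hs hb =>
    have hmem : ∀ e ∈ G c', e ∈ {c} ∪ ⋃ c' ∈ {b | R c b}, G c' := fun e he =>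
      Or.inr (Set.mem_biUnion (show c' ∈ {b | R c b} from hs) he)
    rcases hG' c' n b hb with h | ⟨e, he, i, j, hi, hj, hij, h⟩
    · exact Or.inl (hmem _ h)
    · refine Or.inr ⟨e, hmem _ he, i + 1, j, hi.head hs, hj, by omega, ?_⟩
      rcases h with (h | h) | ⟨e₀, k, l, hk, hl, hkl, h⟩
      · exact Or.inl h
      · exact Or.inr ⟨c, 0, i, .refl _, hi.head hs, by omega, h⟩
      · exact Or.inr ⟨e₀, k + 1, l, hk.head hs, hl, by omega, h⟩

/-- In a finitely branching transition system with well-quasi-ordered elements, only finitely many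
elements are reached without passing through one of finitely many elements that lie above a
different predecessor. -/
theorem exists_finite_or_repetition {α : Type*} {r R : α → α → Prop}
    (hr : WellQuasiOrdered r) (hR : ∀ a, {b | R a b}.Finite) (a : α) :
    ∃ F : Set α, F.Finite ∧ ∀ b, Relation.ReflTransGen R a b → b ∈ F ∨ ∃ e ∈ F, ∃ e₀,
      Relation.ReflTransGen R a e₀ ∧ Relation.ReflTransGen R e₀ e ∧
        Relation.ReflTransGen R e b ∧ r e₀ e ∧ e₀ ≠ e := by
  classical
  obtain ⟨F, hF, h⟩ := exists_finite_or_repetition_aux hr hR ∅ a (Set.notMem_empty a)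
  refine ⟨F, hF, fun b hb => ?_⟩
  have hex := StepsIn.exists_of_reflTransGen hb
  rcases h _ b (Nat.find_spec hex) with h | ⟨e, he, i, j, hi, hj, hij, h | ⟨e₀, k, l, hk, hl, hkl, h⟩⟩
  · exact Or.inl h
  · exact absurd h (Set.notMem_empty e)
  · refine Or.inr ⟨e, he, e₀, hk.reflTransGen, hl.reflTransGen, hj.reflTransGen, h, ?_⟩
    rintro rfl
    -- If `e₀ = e`, cutting out the loop would shorten a shortest run.
    have := Nat.find_min' hex (hk.trans hj)
    omega

open Relation

/-! ### Sections and the encoding of states by counters -/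

/-- Fixing the coordinates outside the range of an order embedding of index sets gives a
section. -/
theorem section_mem_secReachVAS {d D : ℕ} (V : VAS D) (ι : Fin d ↪o Fin D) (u : Fin D → ℕ) :
    (⟨d, {v | ∃ w ∈ V.reach, w ∘ ι = v ∧ ∀ i ∉ Set.range ι, w i = u i}⟩ : VecSet) ∈
      SecReachVAS := by
  set I : Finset (Fin D) := Finset.univ.map ι.toEmbedding with hI
  have hcard : I.card = d := by simp [hI]
  refine ⟨D, V, I, vecProj Iᶜ u, ?_⟩
  have hvec : ∀ w : Fin D → ℕ, vecProj Iᶜ w = vecProj Iᶜ u ↔ ∀ i ∉ Set.range ι, w i = u i := by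
    intro w
    constructor
    · intro h i hi
      have : i ∈ Set.range (Iᶜ.orderEmbOfFin rfl) := by
        rw [Finset.range_orderEmbOfFin]
        simpa [hI] using hi
      obtain ⟨j, rfl⟩ := this
      exact congrFun h j
    · intro h
      funext j
      refine h _ ?_
      rintro ⟨k, hk⟩
      exact Finset.mem_compl.1 (Finset.orderEmbOfFin_mem Iᶜ rfl j) (hk ▸ by simp [hI])
  have hproj : ∀ w : Fin D → ℕ, vecProj I w = w ∘ ι ∘ Fin.cast hcard := by
    intro w
    have : (ι ∘ Fin.cast hcard) = I.orderEmbOfFin rfl :=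
      Finset.orderEmbOfFin_unique rfl (fun x => by simp [hI])
        (ι.strictMono.comp (Fin.cast_strictMono hcard))
    rw [this]
    rfl
  have : ∀ (n : ℕ) (h : n = d) (X : Set (Fin n → ℕ)) (Y : Set (Fin d → ℕ)),
      (X = (fun v => v ∘ Fin.cast h) '' Y) → (⟨d, Y⟩ : VecSet) = ⟨n, X⟩ := by
    rintro n rfl X Y rfl
    simp [Fin.cast_refl]
  refine this _ hcard _ _ ?_
  ext x
  simp only [vecSection, Set.mem_image, Set.mem_ofPred_eq, hvec, hproj]
  constructor
  · rintro ⟨w, ⟨hw, hu⟩, rfl⟩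
    exact ⟨_, ⟨w, hw, rfl, hu⟩, rfl⟩
  · rintro ⟨_, ⟨w, hw, rfl, hu⟩, rfl⟩
    exact ⟨w, ⟨hw, hu⟩, rfl⟩

/-- The unit vectors, used to encode states. -/
abbrev unitVec (R : Type) [Zero R] [One R] {K : ℕ} (a : Fin K) : Fin K → R := Pi.single a 1

theorem vecStep_append {d K : ℕ} {v : Fin d → ℕ} {t : Fin d → ℤ} {w : Fin d → ℕ}
    {v' : Fin K → ℕ} {t' : Fin K → ℤ} {w' : Fin K → ℕ} :
    VecStep (Fin.append v v') (Fin.append t t') (Fin.append w w') ↔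
      VecStep v t w ∧ VecStep v' t' w' := by
  simp only [VecStep]
  constructor
  · intro h
    exact ⟨fun i => by simpa using h (Fin.castAdd K i), fun i => by simpa using h (Fin.natAdd d i)⟩
  · rintro ⟨h₁, h₂⟩ i
    refine Fin.addCases (fun i => ?_) (fun i => ?_) i
    · simpa using h₁ i
    · simpa using h₂ i

/-- Coordinate `b` must be positive for the subtraction, which tests the state. For `b = c` the
vector is zero and tests nothing; this is why each state has two counters, so that self-loops are
split into two genuine moves. -/
theorem vecStep_unitVec {K : ℕ} {a b c : Fin K} {w : Fin K → ℕ} (hbc : b ≠ c) :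
    VecStep (unitVec ℕ a) (unitVec ℤ c - unitVec ℤ b) w ↔ a = b ∧ w = unitVec ℕ c := by
  constructor
  · intro h
    have hab : a = b := by
      by_contra hne
      have := h b
      simp [unitVec, hbc, Ne.symm hne] at this
    subst hab
    refine ⟨rfl, funext fun i => ?_⟩
    have := h i
    simp only [unitVec, Pi.sub_apply, Pi.single_apply] at this ⊢
    push_cast at this
    zify
    split_ifs at this ⊢ <;> simp_all
  · rintro ⟨rfl, rfl⟩ i
    simp only [unitVec, Pi.sub_apply, Pi.single_apply]
    push_cast
    ring

theorem unitVec_injective {K : ℕ} {a b : Fin K} (h : unitVec ℕ a = unitVec ℕ b) : a = b := by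
  by_contra hne
  have := congrFun h a
  simp [unitVec, hne] at this

namespace VASS

/-- Index of the counter that stands for a state (`false`) or for the preparation of a transition
leaving this state (`true`). -/
noncomputable def stateIndex {d : ℕ} (V : VASS d) : V.Q × Bool ≃ Fin (Nat.card (V.Q × Bool)) :=
  haveI := V.finiteStates
  Finite.equivFin _

open Classical in
/-- The vector addition system simulating a VASS with counters for the states. -/
noncomputable def toVAS {d : ℕ} (V : VASS d) : VAS (d + Nat.card (V.Q × Bool)) :=
  haveI := V.finiteStates
  haveI := Fintype.ofFinite V.Q
  { source := Fin.append V.source.2 (unitVec ℕ (V.stateIndex (V.source.1, false)))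
    transitions :=
      Finset.univ.image (fun p : V.Q => Fin.append 0
        (unitVec ℤ (V.stateIndex (p, true)) - unitVec ℤ (V.stateIndex (p, false)))) ∪
      V.transitions.image (fun t => Fin.append t.2.1
        (unitVec ℤ (V.stateIndex (t.2.2, false)) - unitVec ℤ (V.stateIndex (t.1, true)))) }

theorem toVAS_step_iff {d : ℕ} (V : VASS d) (p : V.Q) (b : Bool) (v : Fin d → ℕ)
    (w : Fin (d + Nat.card (V.Q × Bool)) → ℕ) :
    V.toVAS.Step (Fin.append v (unitVec ℕ (V.stateIndex (p, b)))) w ↔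
      (b = false ∧ w = Fin.append v (unitVec ℕ (V.stateIndex (p, true)))) ∨
      (b = true ∧ ∃ c, V.Step (p, v) c ∧
        w = Fin.append c.2 (unitVec ℕ (V.stateIndex (c.1, false)))) := by
  obtain ⟨w₁, w₂, rfl⟩ : ∃ w₁ w₂, w = Fin.append w₁ w₂ := ⟨_, _, Fin.append_castAdd_natAdd.symm⟩
  have happ : ∀ (x x' : Fin d → ℕ) (y y' : Fin (Nat.card (V.Q × Bool)) → ℕ),
      Fin.append x y = Fin.append x' y' ↔ x = x' ∧ y = y' := by
    intro x x' y y'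
    constructor
    · intro h
      exact ⟨funext fun i => by simpa using congrFun h (Fin.castAdd _ i),
        funext fun i => by simpa using congrFun h (Fin.natAdd _ i)⟩
    · rintro ⟨rfl, rfl⟩; rfl
  have hzero : ∀ x x' : Fin d → ℕ, VecStep x 0 x' ↔ x' = x := by
    intro x x'
    simp only [VecStep, Pi.zero_apply, add_zero, Nat.cast_inj, funext_iff, eq_comm]
  simp only [VAS.Step, toVAS, Finset.mem_union, Finset.mem_image, Finset.mem_univ, true_and,
    happ]
  constructor
  · rintro ⟨t, ⟨p', rfl⟩ | ⟨⟨p', t, q'⟩, ht, rfl⟩, h⟩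
    · rw [vecStep_append, vecStep_unitVec (by simp), hzero] at h
      obtain ⟨rfl, h, rfl⟩ := h
      obtain ⟨rfl, rfl⟩ := Prod.mk.inj (V.stateIndex.injective h)
      exact Or.inl ⟨rfl, rfl, rfl⟩
    · rw [vecStep_append, vecStep_unitVec (by simp)] at h
      obtain ⟨h', h, rfl⟩ := h
      obtain ⟨rfl, rfl⟩ := Prod.mk.inj (V.stateIndex.injective h)
      exact Or.inr ⟨rfl, (q', w₁), ⟨t, ht, h'⟩, rfl, rfl⟩
  · rintro (⟨rfl, rfl, rfl⟩ | ⟨rfl, ⟨q', _⟩, ⟨t, ht, h⟩, rfl, rfl⟩)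
    · exact ⟨_, Or.inl ⟨p, rfl⟩, vecStep_append.2
        ⟨(hzero _ _).2 rfl, (vecStep_unitVec (by simp)).2 ⟨rfl, rfl⟩⟩⟩
    · exact ⟨_, Or.inr ⟨(p, t, q'), ht, rfl⟩, vecStep_append.2
        ⟨h, (vecStep_unitVec (by simp)).2 ⟨rfl, rfl⟩⟩⟩

theorem append_mem_toVAS_reach {d : ℕ} (V : VASS d) (p : V.Q) (v : Fin d → ℕ) :
    Fin.append v (unitVec ℕ (V.stateIndex (p, false))) ∈ V.toVAS.reach ↔ v ∈ V.reach p := by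
  constructor
  · intro h
    have key : ∀ w ∈ V.toVAS.reach, ∃ (c : V.Q × (Fin d → ℕ)) (b : Bool),
        w = Fin.append c.2 (unitVec ℕ (V.stateIndex (c.1, b))) ∧
          ReflTransGen V.Step V.source c := by
      intro w hw
      induction hw with
      | refl => exact ⟨V.source, false, rfl, .refl⟩
      | tail _ hs ih =>
        obtain ⟨c, b, rfl, hc⟩ := ih
        rcases (V.toVAS_step_iff _ _ _ _).1 hs with ⟨rfl, rfl⟩ | ⟨rfl, c', hc', rfl⟩
        · exact ⟨c, true, rfl, hc⟩
        · exact ⟨c', false, rfl, hc.tail hc'⟩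
    obtain ⟨⟨q, w⟩, b, heq, hc⟩ := key _ h
    have h₁ : v = w := funext fun i => by simpa using congrFun heq (Fin.castAdd _ i)
    have h₂ := unitVec_injective (funext fun i => by
      simpa using congrFun heq (Fin.natAdd d i))
    obtain ⟨rfl, -⟩ := Prod.mk.inj (V.stateIndex.injective h₂)
    rw [h₁]
    exact hc
  · intro h
    have key : ∀ c, ReflTransGen V.Step V.source c →
        Fin.append c.2 (unitVec ℕ (V.stateIndex (c.1, false))) ∈ V.toVAS.reach := by
      intro c hc
      induction hc with
      | refl => exact .refl
      | @tail c c' _ hs ih =>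
        exact (ih.tail ((V.toVAS_step_iff _ _ _ _).2 (Or.inl ⟨rfl, rfl⟩))).tail
          ((V.toVAS_step_iff _ _ _ _).2 (Or.inr ⟨rfl, c', hs, rfl⟩))
    exact key _ h

theorem toVAS_reach_elim {d : ℕ} (V : VASS d) (p : V.Q) {w : Fin (d + Nat.card (V.Q × Bool)) → ℕ}
    (hw : w ∈ V.toVAS.reach)
    (h : ∀ i, w (Fin.natAdd d i) = unitVec ℕ (V.stateIndex (p, false)) i) :
    (fun i => w (Fin.castAdd _ i)) ∈ V.reach p := by
  rw [← V.append_mem_toVAS_reach, ← (funext h : _ = unitVec ℕ (V.stateIndex (p, false))),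
    Fin.append_castAdd_natAdd]
  exact hw

/-- Sections of reachability sets of VASSes are sections of reachability sets of VASes. -/
theorem section_mem_secReachVAS {d D : ℕ} (V : VASS D) (q : V.Q) (ι : Fin d ↪o Fin D)
    (u : Fin D → ℕ) :
    (⟨d, {v | ∃ w ∈ V.reach q, w ∘ ι = v ∧ ∀ i ∉ Set.range ι, w i = u i}⟩ : VecSet) ∈
      SecReachVAS := by
  set e : Fin (Nat.card (V.Q × Bool)) → ℕ := unitVec ℕ (V.stateIndex (q, false)) with he
  convert _root_.section_mem_secReachVAS V.toVAS
    (ι.trans (Fin.castAddOrderEmb (Nat.card (V.Q × Bool)))) (Fin.append u e) using 2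
  ext v
  simp only [Set.mem_ofPred_eq]
  constructor
  · rintro ⟨w, hw, rfl, hu⟩
    refine ⟨Fin.append w e, (V.append_mem_toVAS_reach q w).2 hw, ?_, fun i => ?_⟩
    · funext i
      simp
    · refine Fin.addCases (fun i hi => ?_) (fun i _ => ?_) i
      · simp only [Fin.append_left]
        refine hu i ?_
        rintro ⟨j, rfl⟩
        exact hi ⟨j, rfl⟩
      · simp
  · rintro ⟨w, hw, rfl, hu⟩
    refine ⟨fun i => w (Fin.castAdd _ i), V.toVAS_reach_elim q hw fun i => ?_, rfl, fun i hi => ?_⟩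
    · rw [hu]
      · simp [he]
      · rintro ⟨j, hj⟩
        have := congrArg Fin.val hj
        simp at this
        omega
    · refine (hu (Fin.castAdd _ i) ?_).trans (Fin.append_left _ _ _)
      · rintro ⟨j, hj⟩
        exact hi ⟨j, Fin.ext (by simpa using congrArg Fin.val hj)⟩

end VASS

theorem reachVASS_subset_secReachVAS : ReachVASS ⊆ SecReachVAS := by
  rintro _ ⟨d, V, q, rfl⟩
  convert V.section_mem_secReachVAS q (RelEmbedding.refl _) 0 using 2
  ext v
  simp

theorem reachVAS_subset_reachVASS : ReachVAS ⊆ ReachVASS := by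
  classical
  rintro _ ⟨d, V, rfl⟩
  refine ⟨d, ⟨Unit, inferInstance, ((), V.source), V.transitions.image fun t => ((), t, ())⟩, (),
    ?_⟩
  congr 1
  ext v
  constructor
  · intro h
    refine ReflTransGen.lift (r := V.Step) (fun v => ((), v)) ?_ _ _ h
    exact fun a b ⟨t, ht, hs⟩ => ⟨t, Finset.mem_image_of_mem _ ht, hs⟩
  · intro h
    have h : ReflTransGen _ ((), V.source) ((), v) := h
    refine ReflTransGen.lift (p := V.Step) Prod.snd ?_ _ _ h
    rintro a b ⟨t, ht, hs⟩
    refine ⟨t, ?_, hs⟩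
    obtain ⟨t', ht', h⟩ := Finset.mem_image.1 ht
    obtain rfl : t' = t := congrArg (fun x => x.2.1) h
    exact ht'

/-! ### A non-empty VASS set that no VAS reaches -/

/-- The one-dimensional set `{0, 2, 3}`. -/
def gapSet : Set (Fin 1 → ℕ) := {v | v 0 = 0 ∨ v 0 = 2 ∨ v 0 = 3}

theorem gapSet_mem_reachVASS : (⟨1, gapSet⟩ : VecSet) ∈ ReachVASS := by
  refine ⟨1, ⟨Bool, inferInstance, (false, 0),
    {(false, ![0], true), (false, ![2], true), (false, ![3], true)}⟩, true, ?_⟩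
  congr 1
  ext v
  constructor
  · intro h
    refine ReflTransGen.single ?_
    rcases h with h | h | h
    · exact ⟨![0], by simp, fun i => by fin_cases i; simp [h]⟩
    · exact ⟨![2], by simp, fun i => by fin_cases i; simp [h]⟩
    · exact ⟨![3], by simp, fun i => by fin_cases i; simp [h]⟩
  · intro h
    rcases ReflTransGen.cases_tail h with h | ⟨⟨q, w⟩, h, t, ht, hs⟩
    · simp at h
    · have hs := hs 0
      rcases ReflTransGen.cases_tail h with h | ⟨⟨q', w'⟩, -, t', ht', -⟩
      · obtain ⟨rfl, rfl⟩ := Prod.mk.inj h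
        simp only [Finset.mem_insert, Finset.mem_singleton, Prod.mk.injEq, true_and,
          and_true] at ht
        rcases ht with rfl | rfl | rfl <;> simp at hs <;> simp [gapSet] <;> omega
      · simp only [Finset.mem_insert, Finset.mem_singleton, Prod.mk.injEq] at ht ht'
        grind

/-- A positive transition would lead from 3 beyond 3, so the source must be the maximum 3. Then 2
can only arise from 3 by adding -1, but -1 also leads from 2 to the forbidden 1. -/
theorem gapSet_ne_reach (V : VAS 1) : gapSet ≠ V.reach := by
  intro hS
  have hmem : ∀ v, v ∈ V.reach → v 0 = 0 ∨ v 0 = 2 ∨ v 0 = 3 := by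
    rw [← hS]; exact fun v hv => hv
  have hmem' : ∀ n, (n = 0 ∨ n = 2 ∨ n = 3) → (fun _ => n) ∈ V.reach := by
    rw [← hS]; exact fun n hn => hn
  have hstep : ∀ v ∈ V.reach, ∀ t ∈ V.transitions, ∀ n : ℕ, (v 0 : ℤ) + t 0 = n →
      n = 0 ∨ n = 2 ∨ n = 3 := by
    intro v hv t ht n hn
    exact hmem (fun _ => n) (ReflTransGen.tail hv ⟨t, ht, fun i => by fin_cases i; exact hn⟩)
  have h0 := hmem' 0 (by simp)
  have h2 := hmem' 2 (by simp)
  have h3 := hmem' 3 (by simp)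
  have hpos : ∀ t ∈ V.transitions, t 0 ≤ 0 := by
    intro t ht
    by_contra hlt
    have := hstep _ h3 t ht (3 + t 0).toNat (by push_cast; omega)
    omega
  have hone : ∀ t ∈ V.transitions, t 0 ≠ -1 := by
    intro t ht h
    have := hstep _ h2 t ht 1 (by simp [h])
    omega
  have hle : ∀ v ∈ V.reach, v 0 ≤ V.source 0 := by
    intro v hv
    induction hv with
    | refl => exact le_rfl
    | tail _ hs ih =>
      obtain ⟨t, ht, hs⟩ := hs
      have := hs 0
      have := hpos t ht
      omega
  have hsrc : V.source 0 = 3 := by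
    have := hle _ h3
    have := hmem V.source .refl
    omega
  have hne : ∀ v ∈ V.reach, v 0 ≠ 2 := by
    intro v hv
    induction hv with
    | refl => omega
    | @tail v w hv hs ih =>
      obtain ⟨t, ht, hs⟩ := hs
      have := hs 0
      have := hpos t ht
      have := hone t ht
      have := hmem v hv
      omega
  exact hne _ h2 rfl

/-! ### A section with exponential growth -/

/-- A three-dimensional VASS in which the third counter is used to double the second counter, at
most, whenever the first one is incremented. -/
def doublingVASS : VASS 3 where
  Q := Bool
  finiteStates := inferInstance
  source := (false, 0)
  transitions := {(false, ![0, -1, 2], false), (false, ![1, 1, 0], true),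
    (true, ![0, 1, -1], true), (true, 0, false)}

theorem mem_doublingVASS_transitions (q : Bool) (t : Fin 3 → ℤ) (q' : Bool) :
    (q, t, q') ∈ doublingVASS.transitions ↔
      (q = false ∧ t = ![0, -1, 2] ∧ q' = false) ∨ (q = false ∧ t = ![1, 1, 0] ∧ q' = true) ∨
      (q = true ∧ t = ![0, 1, -1] ∧ q' = true) ∨ (q = true ∧ t = 0 ∧ q' = false) := by
  change (q, t, q') ∈ ({_, _, _, _} : Finset (Bool × (Fin 3 → ℤ) × Bool)) ↔ _
  simp only [Finset.mem_insert, Finset.mem_singleton, Prod.mk.injEq]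

/-- The section of the reachability set of `doublingVASS` where the third counter is zero. -/
def doublingSet : Set (Fin 2 → ℕ) :=
  {v | ∃ w ∈ doublingVASS.reach false, w ∘ Fin.castSuccOrderEmb = v ∧
    ∀ i ∉ Set.range (Fin.castSuccOrderEmb (n := 2)), w i = (0 : Fin 3 → ℕ) i}

theorem doublingSet_mem_secReachVAS : (⟨2, doublingSet⟩ : VecSet) ∈ SecReachVAS :=
  doublingVASS.section_mem_secReachVAS false Fin.castSuccOrderEmb 0

/-- In state `false` a unit of the second counter is worth two of the third, so the weight 2y + z is
preserved by the loop there; in state `true` y + z is. Only the increment of the first counter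
doubles the bound. -/
theorem doublingVASS_invariant {c : Bool × (Fin 3 → ℕ)}
    (h : ReflTransGen doublingVASS.Step doublingVASS.source c) :
    c.2 0 ≤ c.2 1 + c.2 2 ∧ (c.1 = false → 2 * c.2 1 + c.2 2 + 2 ≤ 2 * 2 ^ c.2 0) ∧
      (c.1 = true → c.2 1 + c.2 2 + 1 ≤ 2 ^ c.2 0) := by
  induction h with
  | refl => simp [doublingVASS]
  | @tail c c' _ hs ih =>
    obtain ⟨q, v⟩ := c
    obtain ⟨q', w⟩ := c'
    obtain ⟨t, ht, hs⟩ := hs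
    have h₀ := hs 0
    have h₁ := hs 1
    have h₂ := hs 2
    replace ht := (mem_doublingVASS_transitions q t q').1 ht
    rcases ht with ⟨rfl, rfl, rfl⟩ | ⟨rfl, rfl, rfl⟩ | ⟨rfl, rfl, rfl⟩ | ⟨rfl, rfl, rfl⟩ <;>
      simp at h₀ h₁ h₂ ih ⊢
    · rw [← h₀]; omega
    · have : w 0 = v 0 + 1 := by omega
      rw [this, pow_succ]
      omega
    · rw [← h₀]; omega
    · rw [← h₀]; omega

theorem le_and_lt_of_mem_doublingSet {v : Fin 2 → ℕ} (hv : v ∈ doublingSet) :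
    v 0 ≤ v 1 ∧ v 1 < 2 ^ v 0 := by
  obtain ⟨w, hw, rfl, h⟩ := hv
  have h2 : w 2 = 0 := h 2 (by rintro ⟨i, hi⟩; fin_cases i <;> simp [Fin.ext_iff] at hi)
  obtain ⟨h₁, h₃, -⟩ := doublingVASS_invariant hw
  have h₃ := h₃ rfl
  simp only [h2, add_zero] at h₁ h₃
  constructor
  · exact h₁
  · change w 1 < 2 ^ w 0
    omega

/-- Emptying the second counter, incrementing, and pouring everything back turns y into 2y + 1. -/
theorem mem_doublingSet (n : ℕ) : ![n, 2 ^ n - 1] ∈ doublingSet := by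
  have hA : ∀ n T k : ℕ, (![n, T + k, 0] : Fin 3 → ℕ) ∈ doublingVASS.reach false →
      (![n, T, 2 * k] : Fin 3 → ℕ) ∈ doublingVASS.reach false := by
    intro n T k
    induction k generalizing T with
    | zero => exact id
    | succ k ih =>
      intro h
      refine ReflTransGen.tail (ih (T + 1) (by convert h using 3; omega))
        ⟨![0, -1, 2], (mem_doublingVASS_transitions _ _ _).2 (by simp), fun i => ?_⟩
      fin_cases i <;> simp
      ring
  have hB : ∀ n T k : ℕ, (![n, T, k] : Fin 3 → ℕ) ∈ doublingVASS.reach true →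
      (![n, T + k, 0] : Fin 3 → ℕ) ∈ doublingVASS.reach true := by
    intro n T k
    induction k generalizing T with
    | zero => exact id
    | succ k ih =>
      intro h
      rw [Nat.add_comm k, ← Nat.add_assoc]
      refine ih (T + 1) (ReflTransGen.tail h
        ⟨![0, 1, -1], (mem_doublingVASS_transitions _ _ _).2 (by simp), fun i => ?_⟩)
      fin_cases i <;> simp
  have key : (![n, 2 ^ n - 1, 0] : Fin 3 → ℕ) ∈ doublingVASS.reach false := by
    induction n with
    | zero =>
      have : (![0, 2 ^ 0 - 1, 0] : Fin 3 → ℕ) = 0 := by ext i; fin_cases i <;> rfl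
      rw [this]
      exact .refl
    | succ n ih =>
      have h₁ := hA n 0 (2 ^ n - 1) (by simpa using ih)
      have h₂ : (![n + 1, 1, 2 * (2 ^ n - 1)] : Fin 3 → ℕ) ∈ doublingVASS.reach true :=
        ReflTransGen.tail h₁ ⟨![1, 1, 0], (mem_doublingVASS_transitions _ _ _).2 (by simp), fun i => by
          fin_cases i <;> simp⟩
      have h₃ := hB _ _ _ h₂
      have : 1 + 2 * (2 ^ n - 1) = 2 ^ (n + 1) - 1 := by
        have := Nat.one_le_two_pow (n := n)
        rw [pow_succ]; omega
      rw [this] at h₃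
      exact ReflTransGen.tail h₃ ⟨0, (mem_doublingVASS_transitions _ _ _).2 (by simp), fun i => by simp⟩
  refine ⟨_, key, ?_, fun i hi => ?_⟩
  · ext i; fin_cases i <;> rfl
  · fin_cases i
    · exact absurd ⟨0, rfl⟩ hi
    · exact absurd ⟨1, rfl⟩ hi
    · rfl

/-! ### Walks in the control graph and pumping -/

namespace VASS

/-- `V.Walk n r g r'`: the control graph of `V` has a walk of length `n` from `r` to `r'` whose
total effect is `g`; the counters are not required to stay non-negative. -/
inductive Walk {d : ℕ} (V : VASS d) : ℕ → V.Q → (Fin d → ℤ) → V.Q → Prop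
  | nil (r : V.Q) : Walk V 0 r 0 r
  | cons {n : ℕ} {r r' r'' : V.Q} {t g : Fin d → ℤ} :
      (r, t, r') ∈ V.transitions → Walk V n r' g r'' → Walk V (n + 1) r (t + g) r''

/-- Reachability in the control graph. -/
def Conn {d : ℕ} (V : VASS d) (r r' : V.Q) : Prop :=
  ∃ n g, V.Walk n r g r'

/-- The configuration with state `r` and integer counter values `z` is reachable; in particular `z`
is non-negative. -/
def ReachInt {d : ℕ} (V : VASS d) (r : V.Q) (z : Fin d → ℤ) : Prop :=
  ∃ v, ReflTransGen V.Step V.source (r, v) ∧ ∀ i, (v i : ℤ) = z i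

theorem Walk.trans {d : ℕ} {V : VASS d} {m n : ℕ} {r r' r'' : V.Q} {g h : Fin d → ℤ}
    (h₁ : V.Walk m r g r') (h₂ : V.Walk n r' h r'') : V.Walk (m + n) r (g + h) r'' := by
  induction h₁ with
  | nil => simpa using h₂
  | cons ht _ ih =>
    convert (ih h₂).cons ht using 1
    · omega
    · rw [add_assoc]

theorem Walk.single {d : ℕ} {V : VASS d} {r r' : V.Q} {t : Fin d → ℤ}
    (ht : (r, t, r') ∈ V.transitions) : V.Walk 1 r t r' := by
  simpa using (Walk.nil r').cons ht

theorem Conn.refl {d : ℕ} {V : VASS d} (r : V.Q) : V.Conn r r := ⟨_, _, .nil r⟩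

theorem Conn.trans {d : ℕ} {V : VASS d} {r r' r'' : V.Q} (h₁ : V.Conn r r') (h₂ : V.Conn r' r'') :
    V.Conn r r'' := by
  obtain ⟨m, g, hg⟩ := h₁
  obtain ⟨n, h, hh⟩ := h₂
  exact ⟨_, _, hg.trans hh⟩

theorem exists_walk_of_run {d : ℕ} {V : VASS d} {c c' : V.Q × (Fin d → ℕ)}
    (h : ReflTransGen V.Step c c') :
    ∃ n g, V.Walk n c.1 g c'.1 ∧ ∀ i, (c.2 i : ℤ) + g i = c'.2 i := by
  induction h with
  | refl => exact ⟨0, 0, .nil _, by simp⟩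
  | tail _ hs ih =>
    obtain ⟨n, g, hg, h⟩ := ih
    obtain ⟨t, ht, hs⟩ := hs
    refine ⟨n + 1, g + t, hg.trans (.single ht), fun i => ?_⟩
    rw [← hs i, ← h i, Pi.add_apply, add_assoc]

theorem exists_abs_transition_le {d : ℕ} (V : VASS d) :
    ∃ B : ℕ, ∀ r t r', (r, t, r') ∈ V.transitions → ∀ i, |t i| ≤ B := by
  refine ⟨∑ t ∈ V.transitions, ∑ i, (t.2.1 i).natAbs, fun r t r' ht i => ?_⟩
  have h₁ : (t i).natAbs ≤ ∑ i, (t i).natAbs :=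
    Finset.single_le_sum (f := fun i => (t i).natAbs) (fun _ _ => Nat.zero_le _) (Finset.mem_univ i)
  have h₂ : ∑ i, (t i).natAbs ≤ ∑ t ∈ V.transitions, ∑ i, (t.2.1 i).natAbs :=
    Finset.single_le_sum (f := fun t : V.Q × (Fin d → ℤ) × V.Q => ∑ i, (t.2.1 i).natAbs)
      (fun _ _ => Nat.zero_le _) ht
  rw [Int.abs_eq_natAbs]
  exact_mod_cast h₁.trans h₂

theorem Walk.abs_le {d : ℕ} {V : VASS d} {B : ℕ}
    (hB : ∀ r t r', (r, t, r') ∈ V.transitions → ∀ i, |t i| ≤ B) {n : ℕ} {r r' : V.Q}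
    {g : Fin d → ℤ} (h : V.Walk n r g r') (i : Fin d) : |g i| ≤ B * n := by
  induction h with
  | nil => simp
  | cons ht _ ih =>
    have := hB _ _ _ ht i
    push_cast
    rw [Pi.add_apply]
    linarith [abs_add_le (_ : ℤ) (_ : ℤ) |>.trans (add_le_add this ih)]

theorem ReachInt.walk {d : ℕ} {V : VASS d} {B : ℕ}
    (hB : ∀ r t r', (r, t, r') ∈ V.transitions → ∀ i, |t i| ≤ B) {n : ℕ} {r r' : V.Q}
    {g z : Fin d → ℤ} (hz : V.ReachInt r z) (h : V.Walk n r g r') (hle : ∀ i, B * n ≤ z i) :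
    V.ReachInt r' (z + g) := by
  induction h generalizing z with
  | nil => simpa using hz
  | @cons n r r₁ r₂ t g ht _ ih =>
    rw [← add_assoc]
    have hle' : ∀ i, (B : ℤ) * n ≤ (z + t) i := fun i => by
      have h₁ := hle i
      have h₂ := (abs_le.1 (hB _ _ _ ht i)).1
      push_cast at h₁
      rw [Pi.add_apply]
      linarith
    refine ih ?_ hle'
    obtain ⟨v, hv, hvz⟩ := hz
    have hnn : ∀ i, 0 ≤ (z + t) i := fun i => le_trans (by positivity) (hle' i)
    exact ⟨fun i => ((z + t) i).toNat, hv.tail ⟨t, ht, fun i => by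
      rw [Int.toNat_of_nonneg (hnn i), hvz]; rfl⟩, fun i => Int.toNat_of_nonneg (hnn i)⟩

theorem ReachInt.iterate {d : ℕ} {V : VASS d} {B : ℕ}
    (hB : ∀ r t r', (r, t, r') ∈ V.transitions → ∀ i, |t i| ≤ B) {n : ℕ} {r : V.Q}
    {g z : Fin d → ℤ} (hz : V.ReachInt r z) (h : V.Walk n r g r) (k : ℕ)
    (hle : ∀ j < k, ∀ i, B * n ≤ z i + j * g i) :
    V.ReachInt r (z + (k : ℤ) • g) := by
  induction k with
  | zero => simpa using hz
  | succ k ih =>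
    have := (ih fun j hj => hle j (hj.trans k.lt_succ_self)).walk hB h fun i => by
      simpa using hle k k.lt_succ_self i
    convert this using 1
    push_cast
    rw [add_smul, one_smul, add_assoc]

theorem run_add {d : ℕ} {V : VASS d} {c c' : V.Q × (Fin d → ℕ)} (h : ReflTransGen V.Step c c')
    (w : Fin d → ℕ) : ReflTransGen V.Step (c.1, c.2 + w) (c'.1, c'.2 + w) := by
  induction h with
  | refl => exact .refl
  | tail _ hs ih =>
    obtain ⟨t, ht, hs⟩ := hs
    refine ih.tail ⟨t, ht, fun i => ?_⟩
    have := hs i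
    simp only [Pi.add_apply]
    push_cast
    linarith

theorem run_pump {d : ℕ} {V : VASS d} {p : V.Q} {v δ : Fin d → ℕ}
    (h : ReflTransGen V.Step (p, v) (p, v + δ)) (M : ℕ) :
    ReflTransGen V.Step (p, v) (p, v + M • δ) := by
  induction M with
  | zero => simpa using ReflTransGen.refl
  | succ M ih =>
    have := run_add h (M • δ)
    refine ih.trans ?_
    rw [succ_nsmul', ← add_assoc]
    exact this

theorem Walk.exists_path {d : ℕ} {V : VASS d} {n : ℕ} {r r' : V.Q} {g : Fin d → ℤ}
    (h : V.Walk n r g r') : ∃ (p : ℕ → V.Q) (G : ℕ → Fin d → ℤ), p 0 = r ∧ p n = r' ∧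
      G 0 = 0 ∧ G n = g ∧ ∀ i < n, (p i, G (i + 1) - G i, p (i + 1)) ∈ V.transitions := by
  induction h with
  | nil r => exact ⟨fun _ => r, fun _ => 0, rfl, rfl, rfl, rfl, by simp⟩
  | @cons n r r₁ r₂ t g ht _ ih =>
    obtain ⟨p, G, hp0, hpn, hG0, hGn, hT⟩ := ih
    refine ⟨fun i => Nat.casesOn i r p, fun i => Nat.casesOn i 0 fun i => t + G i, rfl, hpn, rfl,
      congrArg (t + ·) hGn, fun i hi => ?_⟩
    cases i with
    | zero => simpa [hp0, hG0] using ht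
    | succ i => simpa using hT i (Nat.lt_of_succ_lt_succ hi)

theorem walk_of_path {d : ℕ} {V : VASS d} {n : ℕ} {p : ℕ → V.Q} {G : ℕ → Fin d → ℤ}
    (hT : ∀ i < n, (p i, G (i + 1) - G i, p (i + 1)) ∈ V.transitions) {i j : ℕ} (hij : i ≤ j)
    (hj : j ≤ n) : V.Walk (j - i) (p i) (G j - G i) (p j) := by
  induction j, hij using Nat.le_induction with
  | base => simpa using Walk.nil (p i)
  | succ j hij ih =>
    have := (ih (by omega)).trans (.single (hT j (by omega)))
    convert this using 1
    · omega
    · abel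

/-- A long walk contains a short cycle. -/
theorem Walk.exists_cycle {d : ℕ} {V : VASS d} {n : ℕ} {r r' : V.Q} {g : Fin d → ℤ}
    (h : V.Walk n r g r') (hn : Nat.card V.Q ≤ n) :
    ∃ u n₁ n₂ n₃ g₁ g₂ g₃, V.Walk n₁ r g₁ u ∧ V.Walk n₂ u g₂ u ∧ V.Walk n₃ u g₃ r' ∧
      0 < n₂ ∧ n₂ ≤ Nat.card V.Q ∧ n = n₁ + n₂ + n₃ ∧ g = g₁ + g₂ + g₃ := by
  have := V.finiteStates
  have := Fintype.ofFinite V.Q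
  obtain ⟨p, G, rfl, rfl, hG0, rfl, hT⟩ := h.exists_path
  obtain ⟨i, j, hne, hij⟩ := Fintype.exists_ne_map_eq_of_card_lt
    (fun i : Fin (Nat.card V.Q + 1) => p i) (by simp [Nat.card_eq_fintype_card])
  wlog hlt : i < j generalizing i j
  · exact this j i hne.symm hij.symm (lt_of_le_of_ne (not_lt.1 hlt) hne.symm)
  have hlt : (i : ℕ) < j := hlt
  have hjn : (j : ℕ) ≤ n := by omega
  have hij : p i = p j := hij
  refine ⟨p i, i, j - i, n - j, G i, G j - G i, G n - G j, ?_, ?_, ?_, by omega, by omega,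
    by omega, by abel⟩
  · simpa [hG0] using walk_of_path hT (Nat.zero_le i) (by omega)
  · have := walk_of_path hT hlt.le hjn
    rwa [← hij] at this
  · rw [hij]
    exact walk_of_path hT hjn le_rfl

/-- Combining a cycle that moves right with a cycle, executable afterwards, that does not move
right, never has a purely upwards effect if the reachability set is bounded above on vertical
lines. -/
theorem slope_le_of_bounded {V : VASS 2} {q : V.Q}
    (hbd : ∀ x, ∃ Y, ∀ v ∈ V.reach q, v 0 = x → v 1 ≤ Y)
    {p : V.Q} {v δ : Fin 2 → ℕ} (hp : ∀ M : ℕ, ReflTransGen V.Step V.source (p, v + M • δ))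
    (hδ : ∀ i, 1 ≤ δ i) {r' r : V.Q} (hpr : V.Conn p r') (hrr : V.Conn r' r) (hrq : V.Conn r q)
    {n₁ n₂ : ℕ} {g₁ g₂ : Fin 2 → ℤ} (h₁ : V.Walk n₁ r' g₁ r') (h₂ : V.Walk n₂ r g₂ r)
    (hx₁ : 1 ≤ g₁ 0) (hy₁ : 0 ≤ g₁ 1) (hx₂ : g₂ 0 ≤ 0) : g₁ 0 * g₂ 1 ≤ g₁ 1 * g₂ 0 := by
  by_contra! hlt
  obtain ⟨B, hB⟩ := V.exists_abs_transition_le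
  obtain ⟨na, ga, ha⟩ := hpr
  obtain ⟨nb, gb, hb⟩ := hrr
  obtain ⟨nc, gc, hc⟩ := hrq
  -- Taking the first cycle β times and the second α times cancels the horizontal effect and gains
  -- at least 1 vertically.
  obtain ⟨α, hα⟩ := Int.eq_ofNat_of_zero_le (show 0 ≤ g₁ 0 by omega)
  obtain ⟨β, hβ⟩ := Int.eq_ofNat_of_zero_le (show 0 ≤ -g₂ 0 by omega)
  -- Enough pumping to pay for the three connecting walks and one pass of each cycle.
  set M := B * (na + nb + nc + n₁ + n₂) with hM
  set z : Fin 2 → ℤ := fun i => (v i : ℤ) + M * δ i with hz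
  have hzM : ∀ i, (B : ℤ) * na + B * nb + B * nc + B * n₁ + B * n₂ ≤ z i := by
    intro i
    have h₁ : (M : ℤ) * 1 ≤ M * δ i :=
      mul_le_mul_of_nonneg_left (by exact_mod_cast hδ i) (by positivity)
    have h₂ : (M : ℤ) = B * na + B * nb + B * nc + B * n₁ + B * n₂ := by
      rw [hM]; push_cast; ring
    have h₃ : (0 : ℤ) ≤ v i := by positivity
    simp only [hz]
    linarith
  have hnn : ∀ m : ℕ, (0 : ℤ) ≤ B * m := fun m => by positivity
  have hga := fun i => (abs_le.1 (ha.abs_le hB i)).1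
  have hgb := fun i => (abs_le.1 (hb.abs_le hB i)).1
  have hg₁ : ∀ i, 0 ≤ g₁ i := fun i => by
    fin_cases i
    · exact le_trans zero_le_one hx₁
    · exact hy₁
  have key : ∀ k : ℕ, V.ReachInt q (z + ga + ((k * β : ℕ) : ℤ) • g₁ + gb +
      ((k * α : ℕ) : ℤ) • g₂ + gc) := by
    intro k
    -- The partial sums are affine in `j`, so non-negativity at `j = 0` and `j = k * α` suffices.
    have hcomb : ∀ j ≤ k * α, ∀ i, 0 ≤ ((k * β : ℕ) : ℤ) * g₁ i + j * g₂ i := by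
      intro j hj i
      have hj' : (j : ℤ) ≤ k * α := by exact_mod_cast hj
      fin_cases i
      · have h0 : g₂ 0 = -β := by omega
        have : (j : ℤ) * β ≤ k * α * β := mul_le_mul_of_nonneg_right hj' (by positivity)
        simp only [Fin.zero_eta, hα, h0]
        push_cast
        linarith
      · simp only [Fin.mk_one]
        rcases le_or_gt 0 (g₂ 1) with h | h
        · positivity
        · have h0 : g₂ 0 = -β := by omega
          have h1 : (k : ℤ) * α * g₂ 1 ≤ j * g₂ 1 := mul_le_mul_of_nonpos_right hj' h.le
          have h2 : (0 : ℤ) ≤ k * (β * g₁ 1 + α * g₂ 1) := by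
            refine mul_nonneg (by positivity) ?_
            rw [h0, hα] at hlt
            linarith
          push_cast
          linarith
    have hnβ : ∀ i, 0 ≤ ((k * β : ℕ) : ℤ) * g₁ i := fun i => mul_nonneg (by positivity) (hg₁ i)
    have s₀ : V.ReachInt p z := ⟨_, hp M, fun i => by simp [hz]⟩
    have s₁ := s₀.walk hB ha fun i => by linarith [hzM i, hnn nb, hnn nc, hnn n₁, hnn n₂]
    have s₂ := s₁.iterate hB h₁ (k * β) fun j _ i => by
      have : 0 ≤ (j : ℤ) * g₁ i := mul_nonneg (by positivity) (hg₁ i)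
      rw [Pi.add_apply]
      linarith [hzM i, hga i, hnn nb, hnn nc, hnn n₁, hnn n₂]
    have s₃ := s₂.walk hB hb fun i => by
      simp only [Pi.add_apply, Pi.smul_apply, smul_eq_mul]
      linarith [hzM i, hga i, hnβ i, hnn nb, hnn nc, hnn n₁, hnn n₂]
    have s₄ := s₃.iterate hB h₂ (k * α) fun j hj i => by
      simp only [Pi.add_apply, Pi.smul_apply, smul_eq_mul]
      linarith [hzM i, hga i, hgb i, hcomb j hj.le i, hnn nb, hnn nc, hnn n₁, hnn n₂]
    refine s₄.walk hB hc fun i => ?_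
    simp only [Pi.add_apply, Pi.smul_apply, smul_eq_mul]
    linarith [hzM i, hga i, hgb i, hcomb _ le_rfl i, hnn nb, hnn nc, hnn n₁, hnn n₂]
  obtain ⟨v₀, -, hv₀⟩ := key 0
  obtain ⟨Y, hY⟩ := hbd (v₀ 0)
  obtain ⟨w, hw, hwz⟩ := key (Y + 1)
  have h0 := hwz 0
  have h1 := hwz 1
  have h0' := hv₀ 0
  have h1' := hv₀ 1
  simp only [Pi.add_apply, Pi.smul_apply, smul_eq_mul] at h0 h1 h0' h1'
  push_cast at h0 h1 h0' h1'
  have hb0 : g₂ 0 = -β := by omega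
  have hw0 : w 0 = v₀ 0 := by
    zify
    rw [h0, h0', hα, hb0]
    ring
  have hw1 := hY w hw hw0
  have hpos : 1 ≤ β * g₁ 1 + α * g₂ 1 := by
    rw [hb0, hα] at hlt
    linarith
  have : ((Y : ℤ) + 1) * 1 ≤ (Y + 1) * (β * g₁ 1 + α * g₂ 1) :=
    mul_le_mul_of_nonneg_left hpos (by positivity)
  have : (0 : ℤ) ≤ v₀ 1 := by positivity
  have : (w 1 : ℤ) ≤ Y := by exact_mod_cast hw1
  linarith

end VASS

/-! ### Slopes of cycles and linear bounds -/

namespace VASS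

/-- The slopes of short cycles moving right that are available between the states `p` and `r`. -/
def slopes (V : VASS 2) (p : V.Q) (L : ℕ) (r : V.Q) : Set ℝ :=
  {s | ∃ r' n g, V.Conn p r' ∧ V.Conn r' r ∧ n ≤ L ∧ V.Walk n r' g r' ∧ 1 ≤ g 0 ∧ 0 ≤ g 1 ∧
    s = (g 1 : ℝ) / g 0}

theorem finite_slopes (V : VASS 2) (p : V.Q) (L : ℕ) (r : V.Q) : (V.slopes p L r).Finite := by
  obtain ⟨B, hB⟩ := V.exists_abs_transition_le
  refine ((Set.finite_Icc (fun _ => -((B : ℤ) * L)) (fun _ => (B : ℤ) * L)).image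
    fun g : Fin 2 → ℤ => (g 1 : ℝ) / g 0).subset ?_
  rintro _ ⟨r', n, g, -, -, hn, hg, -, -, rfl⟩
  have : (B : ℤ) * n ≤ B * L :=
    mul_le_mul_of_nonneg_left (by exact_mod_cast hn) (by positivity)
  exact ⟨g, ⟨fun i => (abs_le.1 ((hg.abs_le hB i).trans this)).1,
    fun i => (abs_le.1 ((hg.abs_le hB i).trans this)).2⟩, rfl⟩

/-- From a state in which both counters can be pumped, every cycle lies below a line through the
origin whose slope increases along the control graph. -/
theorem exists_slope {V : VASS 2} {q : V.Q}
    (hbd : ∀ x, ∃ Y, ∀ v ∈ V.reach q, v 0 = x → v 1 ≤ Y)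
    {p : V.Q} {v δ : Fin 2 → ℕ} (hp : ReflTransGen V.Step V.source (p, v))
    (hloop : ReflTransGen V.Step (p, v) (p, v + δ)) (hδ : ∀ i, 1 ≤ δ i) :
    ∃ σ : V.Q → ℝ, (∀ r r', V.Conn p r → V.Conn r r' → σ r ≤ σ r') ∧
      ∀ r n g, V.Conn p r → V.Conn r q → V.Walk n r g r → (g 1 : ℝ) ≤ σ r * g 0 := by
  obtain ⟨nδ, g', hwδ, hgδ⟩ := exists_walk_of_run hloop
  have hgδ : ∀ i, g' i = δ i := fun i => by
    have := hgδ i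
    simp only [Pi.add_apply] at this
    push_cast at this
    linarith
  set L := max (Nat.card V.Q) nδ with hL
  have hne : ∀ r, V.Conn p r → (V.slopes p L r).Nonempty := fun r hr =>
    ⟨_, p, nδ, g', .refl p, hr, le_max_right _ _, hwδ, by rw [hgδ]; exact_mod_cast hδ 0,
      by rw [hgδ]; positivity, rfl⟩
  have hfin := V.finite_slopes p L
  have hmono : ∀ r r', V.Conn p r → V.Conn r r' → sSup (V.slopes p L r) ≤ sSup (V.slopes p L r') := by
    intro r r' hr hrr'
    refine csSup_le_csSup (hfin r').bddAbove (hne r hr) ?_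
    rintro s ⟨u, n, g, h₁, h₂, h⟩
    exact ⟨u, n, g, h₁, h₂.trans hrr', h⟩
  refine ⟨fun r => sSup (V.slopes p L r), hmono, ?_⟩
  intro r n
  induction n using Nat.strong_induction_on generalizing r with
  | _ n ih =>
  intro g hpr hrq hg
  by_cases hn : n ≤ L
  · obtain ⟨u, m, h, hpu, hur, -, hh, hx, hy, hs⟩ := (hne r hpr).csSup_mem (hfin r)
    have hx' : (0 : ℝ) < h 0 := by exact_mod_cast hx
    have hy' : (0 : ℝ) ≤ h 1 := by exact_mod_cast hy
    rcases lt_or_ge 0 (g 0) with hg0 | hg0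
    · have hg0' : (0 : ℝ) < g 0 := by exact_mod_cast hg0
      rcases le_or_gt 0 (g 1) with hg1 | hg1
      · rw [← div_le_iff₀ hg0']
        exact le_csSup (hfin r).bddAbove ⟨r, n, g, hpr, .refl r, hn, hg, hg0, hg1, rfl⟩
      · have hg1' : (g 1 : ℝ) ≤ 0 := by exact_mod_cast hg1.le
        refine hg1'.trans (mul_nonneg ?_ hg0'.le)
        simp only [hs]
        positivity
    -- A cycle not moving right is compared with the cycle `h` attaining the supremum.
    · have := slope_le_of_bounded hbd (fun M => hp.trans (run_pump hloop M)) hδ hpu hur hrq hh hg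
        hx hy hg0
      have : (h 0 : ℝ) * g 1 ≤ h 1 * g 0 := by exact_mod_cast this
      simp only [hs]
      rw [div_mul_eq_mul_div, le_div_iff₀ hx']
      linarith
  · obtain ⟨u, n₁, n₂, n₃, g₁, g₂, g₃, h₁, h₂, h₃, hpos, hle, rfl, rfl⟩ :=
      hg.exists_cycle (by omega)
    have hru : V.Conn r u := ⟨_, _, h₁⟩
    have hur : V.Conn u r := ⟨_, _, h₃⟩
    -- `u` and `r` are mutually reachable, so the removed cycle and the remaining one obey the same
    -- slope.
    have hσ : sSup (V.slopes p L u) = sSup (V.slopes p L r) :=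
      le_antisymm (hmono u r (hpr.trans hru) hur) (hmono r u hpr hru)
    have i₁ := ih n₂ (by omega) u g₂ (hpr.trans hru) (hur.trans hrq) h₂
    have hcard : 0 < n₁ + n₃ := by omega
    have i₂ := ih (n₁ + n₃) (by omega) r (g₁ + g₃) hpr hrq (h₁.trans h₃)
    simp only [hσ, Pi.add_apply] at i₁ i₂ ⊢
    push_cast at i₁ i₂ ⊢
    linarith

/-- Given slopes as in `VASS.exists_slope`, all runs stay below a line. -/
theorem exists_linear_bound_of_slope {V : VASS 2} {q p : V.Q} {σ : V.Q → ℝ}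
    (hmono : ∀ r r', V.Conn p r → V.Conn r r' → σ r ≤ σ r')
    (hσ : ∀ r n g, V.Conn p r → V.Conn r q → V.Walk n r g r → (g 1 : ℝ) ≤ σ r * g 0) :
    ∃ A : ℝ, ∀ v, ∃ C : ℝ, ∀ w, ReflTransGen V.Step (p, v) (q, w) → (w 1 : ℝ) ≤ A * w 0 + C := by
  classical
  have := V.finiteStates
  obtain ⟨B, hB⟩ := V.exists_abs_transition_le
  obtain ⟨D₁, hD₁⟩ : ∃ D₁ : ℝ, ∀ r₀ r n h, V.Conn p r₀ → V.Conn r q → V.Conn r r₀ →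
      V.Walk n r₀ h r → (h 1 : ℝ) ≤ σ r₀ * h 0 + D₁ := by
    -- A fixed return walk closes any walk within a component to a cycle, at bounded cost.
    choose! n g hg using fun (x : V.Q × V.Q) (hx : V.Conn x.1 x.2) => hx
    obtain ⟨D, hD⟩ := (Set.finite_range fun x : V.Q × V.Q => σ x.2 * g x 0 - g x 1).bddAbove
    refine ⟨D, fun r₀ r m h hp hq hr hw => ?_⟩
    have h₁ := hσ r₀ _ _ hp (Conn.trans ⟨_, _, hw⟩ hq) (hw.trans (hg (r, r₀) hr))
    have h₂ : σ r₀ * g (r, r₀) 0 - g (r, r₀) 1 ≤ D := hD ⟨(r, r₀), rfl⟩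
    simp only [Pi.add_apply] at h₁
    push_cast at h₁
    linarith
  obtain ⟨D₂, hD₂⟩ : ∃ D₂ : ℝ, ∀ r t r', (r, t, r') ∈ V.transitions →
      (t 1 : ℝ) - σ r' * t 0 ≤ D₂ := by
    obtain ⟨D, hD⟩ := (V.transitions.finite_toSet.image
      fun x => (x.2.1 1 : ℝ) - σ x.2.2 * x.2.1 0).bddAbove
    exact ⟨D, fun r t r' ht => hD ⟨_, ht, rfl⟩⟩
  set D := max 0 (D₁ + D₂) with hD
  -- The rank grows strictly whenever a run leaves a strongly connected component, so the loss `D`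
  -- is paid at most `Nat.card V.Q` times.
  set rank : V.Q → ℕ := fun r => {u | V.Conn u r}.ncard with hrank
  -- `(r₀, w₀)` is the point where the run entered its current component.
  have inv : ∀ (v : Fin 2 → ℕ) (c : V.Q × (Fin 2 → ℕ)), ReflTransGen V.Step (p, v) c →
      V.Conn c.1 q → ∃ (r₀ : V.Q) (w₀ : Fin 2 → ℕ) (n : ℕ) (h : Fin 2 → ℤ), V.Conn p r₀ ∧
        V.Conn c.1 r₀ ∧ V.Walk n r₀ h c.1 ∧ (∀ i, (w₀ i : ℤ) + h i = c.2 i) ∧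
        (w₀ 1 : ℝ) ≤ σ r₀ * w₀ 0 + (v 1 - σ p * v 0 + D * rank r₀) := by
    intro v c hc
    induction hc with
    | refl =>
      intro _
      refine ⟨p, v, 0, 0, .refl p, .refl p, .nil p, by simp, ?_⟩
      have : 0 ≤ D * rank p := mul_nonneg (le_max_left _ _) (by positivity)
      linarith
    | @tail c c' _ hs ih =>
      intro hq
      obtain ⟨t, ht, hs⟩ := hs
      have hcc' : V.Conn c.1 c'.1 := ⟨_, _, .single ht⟩
      obtain ⟨r₀, w₀, n, h, hp₀, hback, hw, hwc, hle⟩ := ih (hcc'.trans hq)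
      have hr₀ : V.Conn r₀ c.1 := ⟨_, _, hw⟩
      by_cases hb : V.Conn c'.1 r₀
      · exact ⟨r₀, w₀, n + 1, h + t, hp₀, hb, hw.trans (.single ht), fun i => by
          rw [← hs i, ← hwc i, Pi.add_apply, add_assoc], hle⟩
      · refine ⟨c'.1, c'.2, 0, 0, (hp₀.trans hr₀).trans hcc', .refl _, .nil _, by simp, ?_⟩
        have hlt : rank r₀ < rank c'.1 := by
          refine Set.ncard_lt_ncard ⟨fun u hu => ?_, fun hsub => hb ?_⟩ (Set.toFinite _)
          · exact (Conn.trans hu hr₀).trans hcc'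
          · exact hsub (Conn.refl c'.1)
        have hlt' : D * (rank r₀ + 1) ≤ D * rank c'.1 :=
          mul_le_mul_of_nonneg_left (by exact_mod_cast hlt) (le_max_left _ _)
        have e₁ := hD₁ r₀ c.1 n h hp₀ (hcc'.trans hq) hback hw
        have e₂ := hD₂ _ _ _ ht
        have e₃ : D₁ + D₂ ≤ D := le_max_right _ _
        have x0 : (c'.2 0 : ℝ) = c.2 0 + t 0 := by exact_mod_cast (hs 0).symm
        have x1 : (c'.2 1 : ℝ) = c.2 1 + t 1 := by exact_mod_cast (hs 1).symm
        have y0 : (c.2 0 : ℝ) = w₀ 0 + h 0 := by exact_mod_cast (hwc 0).symm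
        have y1 : (c.2 1 : ℝ) = w₀ 1 + h 1 := by exact_mod_cast (hwc 1).symm
        -- Increasing the slope only weakens the bound, since counters are non-negative.
        have hσle : σ r₀ * c.2 0 ≤ σ c'.1 * c.2 0 :=
          mul_le_mul_of_nonneg_right (hmono _ _ hp₀ (hr₀.trans hcc')) (by positivity)
        rw [x0, x1]
        rw [y0] at hσle ⊢
        rw [y1]
        linarith
  refine ⟨σ q, fun v => ⟨v 1 - σ p * v 0 + D * Nat.card V.Q + D₁, fun w hvw => ?_⟩⟩
  obtain ⟨r₀, w₀, n, h, hp₀, hback, hw, hwc, hle⟩ := inv v (q, w) hvw (.refl q)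
  have e₁ := hD₁ r₀ q n h hp₀ (.refl q) hback hw
  have y0 : (w 0 : ℝ) = w₀ 0 + h 0 := by exact_mod_cast (hwc 0).symm
  have y1 : (w 1 : ℝ) = w₀ 1 + h 1 := by exact_mod_cast (hwc 1).symm
  have hσle : σ r₀ * w 0 ≤ σ q * w 0 :=
    mul_le_mul_of_nonneg_right (hmono _ _ hp₀ ⟨_, _, hw⟩) (by positivity)
  have hcard : D * rank r₀ ≤ D * Nat.card V.Q :=
    mul_le_mul_of_nonneg_left (by exact_mod_cast Set.ncard_le_card _) (le_max_left _ _)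
  rw [y0] at hσle ⊢
  rw [y1]
  linarith

theorem finite_setOf_step {d : ℕ} (V : VASS d) (c : V.Q × (Fin d → ℕ)) :
    {c' | V.Step c c'}.Finite := by
  refine (V.transitions.finite_toSet.image
    fun x => (x.2.2, fun i => ((c.2 i : ℤ) + x.2.1 i).toNat)).subset ?_
  rintro ⟨q, w⟩ ⟨t, ht, hs⟩
  refine ⟨_, ht, Prod.ext rfl (funext fun i => ?_)⟩
  simp [hs i]

theorem wellQuasiOrdered_config {d : ℕ} (V : VASS d) :
    WellQuasiOrdered fun c c' : V.Q × (Fin d → ℕ) => c.1 = c'.1 ∧ c.2 ≤ c'.2 :=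
  have := V.finiteStates
  (Finite.wellQuasiOrdered (· = ·)).prod wellQuasiOrdered_le

end VASS

/-! ### Exponential growth against finitely many lines -/

theorem eventually_linear_lt_two_pow (A C : ℝ) :
    ∀ᶠ n : ℕ in Filter.atTop, A * n + C < 2 ^ n - 1 := by
  have h := tendsto_pow_const_div_const_pow_of_one_lt 2 (one_lt_two (α := ℝ))
  filter_upwards [h.eventually_lt_const one_pos,
    Filter.eventually_ge_atTop (⌈|A| + |C| + 1⌉₊ + 1)] with n hn hn'
  rw [div_lt_one (by positivity)] at hn
  have h₁ : |A| + |C| + 1 ≤ n := by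
    refine (Nat.le_ceil _).trans ?_
    exact_mod_cast (Nat.le_succ _).trans hn'
  have h₂ : (1 : ℝ) ≤ n := by exact_mod_cast (Nat.le_add_left _ _).trans hn'
  have h₃ : A * n ≤ |A| * n := mul_le_mul_of_nonneg_right (le_abs_self A) (by positivity)
  have h₄ : |C| * 1 ≤ |C| * n := mul_le_mul_of_nonneg_left h₂ (abs_nonneg C)
  have h₅ : (|A| + |C| + 1) * n ≤ n * n := mul_le_mul_of_nonneg_right h₁ (by positivity)
  have h₆ := le_abs_self C
  nlinarith

theorem doublingSet_ne_reach (V : VASS 2) (q : V.Q) : doublingSet ≠ V.reach q := by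
  intro hS
  have hmem : ∀ v ∈ V.reach q, v 0 ≤ v 1 ∧ v 1 < 2 ^ v 0 := fun v hv =>
    le_and_lt_of_mem_doublingSet (by rw [hS]; exact hv)
  have hbd : ∀ x, ∃ Y, ∀ v ∈ V.reach q, v 0 = x → v 1 ≤ Y := fun x =>
    ⟨2 ^ x, fun v hv hx => hx ▸ (hmem v hv).2.le⟩
  obtain ⟨F, hF, h⟩ := exists_finite_or_repetition V.wellQuasiOrdered_config V.finite_setOf_step
    V.source
  have hline : ∀ e ∈ F, ∃ A C : ℝ, ∀ w, (∃ e₀, ReflTransGen V.Step V.source e₀ ∧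
      ReflTransGen V.Step e₀ e ∧ ReflTransGen V.Step e (q, w) ∧ (e₀.1 = e.1 ∧ e₀.2 ≤ e.2) ∧
      e₀ ≠ e) → (w 1 : ℝ) ≤ A * w 0 + C := by
    rintro ⟨p, v⟩ -
    by_cases hex : ∃ w v₀, ReflTransGen V.Step V.source (p, v₀) ∧
        ReflTransGen V.Step (p, v₀) (p, v) ∧ ReflTransGen V.Step (p, v) (q, w) ∧ v₀ ≤ v ∧ v₀ ≠ v
    · obtain ⟨w, v₀, h₁, h₂, h₃, hle, hne⟩ := hex
      obtain ⟨δ, rfl⟩ := exists_add_of_le hle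
      have hM : ∀ M : ℕ, (w + M • δ) ∈ V.reach q := by
        intro M
        have h₄ := VASS.run_add (h₂.trans h₃) (M • δ)
        exact (h₁.trans (VASS.run_pump h₂ M)).trans h₄
      have hsum : ∀ (M : ℕ) (i : Fin 2), (w + M • δ) i = w i + M * δ i := fun M i => by simp
      -- A vertical δ would violate y < 2^x, a horizontal one x ≤ y.
      have hδ : ∀ i, 1 ≤ δ i := by
        by_cases h0 : δ 0 = 0
        · have h1 : δ 1 ≠ 0 := fun h1 => hne (by
            ext i; fin_cases i <;> simp [h0, h1])
          have := (hmem _ (hM (2 ^ w 0))).2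
          rw [hsum, hsum, h0] at this
          have : 2 ^ w 0 * 1 ≤ 2 ^ w 0 * δ 1 := Nat.mul_le_mul_left _ (by omega)
          simp only [mul_zero, add_zero] at *
          omega
        · by_cases h1 : δ 1 = 0
          · have := (hmem _ (hM (w 1 + 1))).1
            rw [hsum, hsum, h1] at this
            have : (w 1 + 1) * 1 ≤ (w 1 + 1) * δ 0 := Nat.mul_le_mul_left _ (by omega)
            omega
          · intro i
            fin_cases i
            · exact Nat.one_le_iff_ne_zero.2 h0
            · exact Nat.one_le_iff_ne_zero.2 h1
      obtain ⟨σ, hmono, hσ⟩ := VASS.exists_slope hbd h₁ h₂ hδ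
      obtain ⟨A, hA⟩ := VASS.exists_linear_bound_of_slope hmono hσ
      obtain ⟨C, hC⟩ := hA (v₀ + δ)
      exact ⟨A, C, fun w ⟨_, _, _, h, _⟩ => hC w h⟩
    -- No run to `q` passes through this repetition, so any line will do.
    · refine ⟨0, 0, fun w ⟨⟨p₀, v₀⟩, h₁, h₂, h₃, ⟨hp, hle⟩, hne⟩ => (hex ?_).elim⟩
      obtain rfl : p₀ = p := hp
      exact ⟨w, v₀, h₁, h₂, h₃, hle, fun h => hne (by rw [h])⟩
  choose! A C hAC using hline
  -- The condition `e.2 0 < n` keeps the chosen point out of `F`.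
  have hev : ∀ᶠ n : ℕ in Filter.atTop, ∀ e ∈ F, e.2 0 < n ∧ A e * n + C e < 2 ^ n - 1 :=
    (Filter.eventually_all_finite hF).2 fun e _ =>
      (Filter.eventually_gt_atTop _).and (eventually_linear_lt_two_pow _ _)
  obtain ⟨n, hn⟩ := hev.exists
  have hrun : ![n, 2 ^ n - 1] ∈ V.reach q := hS ▸ mem_doublingSet n
  rcases h _ hrun with hmemF | ⟨e, he, e₀, hrest⟩
  · exact lt_irrefl _ (hn _ hmemF).1
  · have h₁ := hAC e he _ ⟨e₀, hrest⟩
    have h₂ := (hn e he).2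
    simp only [Matrix.cons_val_zero, Matrix.cons_val_one, Matrix.cons_val_fin_one] at h₁
    rw [Nat.cast_sub Nat.one_le_two_pow] at h₁
    push_cast at h₁
    linarith

theorem gapSet_notMem_reachVAS : (⟨1, gapSet⟩ : VecSet) ∉ ReachVAS := by
  rintro ⟨d, V, h⟩
  obtain ⟨rfl, h⟩ := Sigma.mk.inj_iff.1 h
  exact gapSet_ne_reach V (eq_of_heq h)

theorem doublingSet_notMem_reachVASS : (⟨2, doublingSet⟩ : VecSet) ∉ ReachVASS := by
  rintro ⟨d, V, q, h⟩
  obtain ⟨rfl, h⟩ := Sigma.mk.inj_iff.1 h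
  exact doublingSet_ne_reach V q (eq_of_heq h)

theorem mainTheorem11 :
    ReachVAS ⊂ ReachVASS ∧ ReachVASS ⊂ SecReachVAS ∧
      (∃ (d : ℕ) (S : Set (Fin d → ℕ)), S.Nonempty ∧
        (⟨d, S⟩ : VecSet) ∈ ReachVASS ∧ (⟨d, S⟩ : VecSet) ∉ ReachVAS) :=
  ⟨⟨reachVAS_subset_reachVASS, fun h => gapSet_notMem_reachVAS (h gapSet_mem_reachVASS)⟩,
    ⟨reachVASS_subset_secReachVAS,
      fun h => doublingSet_notMem_reachVASS (h doublingSet_mem_secReachVAS)⟩,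
    1, gapSet, ⟨0, Or.inl rfl⟩, gapSet_mem_reachVASS, gapSet_notMem_reachVAS⟩
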